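/- Setting. Let $w$ be a tree monomial, i.e. a finite rooted tree whose vertices are corollas (operations), the output of every non-root corolla being plugged into an input of another corolla; the edges between corollas are the internal edges of $w$. Let $w_1,\dots,w_n$ ($n\ge 0$) be subtrees of $w$ (non-empty connected sets of corollas), the monomial relations; a tree monomial contained in $w$ is zero in the monomial operad if and only if it contains some $w_i$. The complex $B_w$. Let $k$ be a field. Mark every internal edge of $w$ either by a tensor $\otimes$ or by a bullet $\bullet$ (the operation is performed); this decomposes $w$ into tensor factors, the maximal subtrees joined by bullets. The bar subcomplex $B_w$ has as $k$-basis those markings for which no tensor factor contains a $w_i$ (equivalently, no $w_i$ has all its internal edges marked by bullets). The differential $D$ sends a marking to the sum of all markings obtained by replacing one tensor by a bullet (markings with a vanishing tensor factor counting as $0$), with the Koszul signs: fixing a linear order on the internal edges, the term in which the tensor at $e$ is replaced has the sign $(-1)^m$, where $m$ is the number of tensors at edges preceding $e$. Then $D^2=0$. Orders. A corolla of a tree is called at the bottom if it is the root corolla or if no other corolla is plugged into it (so both ways of drawing a rooted tree are covered). In a family of subtrees, only the members that are minimal by inclusion are kept; the other ones are unnecessary relations. The pair $(w,\{w_1,\dots,w_n\})$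 is called an order if either $w$ is a single corolla, or there is a corolla at the bottom of $w$ which is contained in exactly one minimal subtree $w_k$ of the family, and the following pair is again an order: the tree $\bar w$ obtained from $w$ by contracting $w_k$ to one corolla, with the family of the images in $\bar w$ of the remaining minimal subtrees $w_i\ne w_k$. Theorem. If $(w,\{w_1,\dots,w_n\})$ is an order, then the full homology of the bar subcomplex $B_w$ of the monomial operad is at most one-dimensional: $$\dim_k H_\bullet(B_w)=\dim_k(\operatorname{Ker} D/\operatorname{Im} D)\in\{0,1\}.$$ -/

import Mathlib

open Finset

/-- A finite rooted tree, seen as the tree of corollas of a tree monomial.  Its vertices `verts`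
are the corollas; the output of every corolla `u` other than the root corolla is plugged into an
input of the corolla `parent u`.  (Free inputs play no role, and the values of `parent` at the
root and outside `verts` are irrelevant.) -/
structure CorollaTree (V : Type*) where
  verts : Finset V
  root : V
  parent : V → V
  root_mem : root ∈ verts
  parent_mem : ∀ u ∈ verts, u ≠ root → parent u ∈ verts
  reaches_root : ∀ u ∈ verts, ∃ n : ℕ, parent^[n] u = root

namespace CorollaTree

variable {V : Type*} [DecidableEq V] (T : CorollaTree V)

/-- The internal edges.  The edge joining `u ≠ root` to `parent u` is encoded by `u`. -/
def edges : Finset V := T.verts.erase T.root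

/-- The internal edges of `T` both of whose ends lie in `s`. -/
def edgesIn (s : Finset V) : Finset V := {u ∈ s | u ∈ T.edges ∧ T.parent u ∈ s}

/-- `t` is the top corolla of the subtree `s`: it lies in `s`, and every other corolla of `s` is
plugged into a corolla of `s`. -/
def IsTop (s : Finset V) (t : V) : Prop :=
  t ∈ s ∧ ∀ u ∈ s, u ≠ t → u ∈ T.edges ∧ T.parent u ∈ s

/-- `s` is the set of corollas of a (non-empty, connected) subtree of `T`. -/
def IsSubtree (s : Finset V) : Prop := s ⊆ T.verts ∧ ∃ t, T.IsTop s t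

/-- `v` is at the bottom of the tree: it is the root corolla, or no corolla is plugged into `v`.
(So both ways of drawing a rooted tree, root down or root up, are covered.) -/
def IsBottom (v : V) : Prop :=
  v ∈ T.verts ∧ (v = T.root ∨ ∀ u ∈ T.edges, T.parent u ≠ v)

/-- The map on corollas that collapses `s` to the single corolla `t`. -/
def collapse (s : Finset V) (t : V) (u : V) : V := if u ∈ s then t else u

/-- The tree obtained by replacing the subtree `s`, with top corolla `t`, by one corolla, which is
again called `t` (all the operations inside `s` are performed). -/
def contract (s : Finset V) (t : V) (h : T.IsTop s t) : CorollaTree V where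
  verts := T.verts.image (collapse s t)
  root := T.root
  parent u := collapse s t (T.parent u)
  root_mem := by
    refine mem_image.2 ⟨T.root, T.root_mem, ?_⟩
    unfold collapse
    split_ifs with hr
    · by_contra hne
      have := (h.2 _ hr (fun e => hne e.symm)).1
      simp [edges] at this
    · rfl
  parent_mem := by
    intro u hu hne
    obtain ⟨x, hx, rfl⟩ := mem_image.1 hu
    refine mem_image_of_mem _ ?_
    by_cases hxs : x ∈ s
    · simp only [collapse, hxs, if_true] at hne ⊢
      by_cases ht : t ∈ T.verts
      · exact T.parent_mem _ ht hne
      · have hxt : x ≠ t := by rintro rfl; exact ht hx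
        exfalso
        have key : ∀ n : ℕ, ∀ y ∈ s, y ∈ T.verts → T.parent^[n] y ≠ T.root := by
          intro n
          induction n with
          | zero =>
            intro y hy hyv hr
            have hyt : y ≠ t := by rintro rfl; exact ht hyv
            have := (h.2 _ hy hyt).1
            simp only [Function.iterate_zero, id] at hr
            simp [edges, hr] at this
          | succ n ih =>
            intro y hy hyv
            have hyt : y ≠ t := by rintro rfl; exact ht hyv
            obtain ⟨h1, h2⟩ := h.2 _ hy hyt
            rw [Function.iterate_succ_apply]
            exact ih _ h2 (T.parent_mem _ hyv (mem_erase.1 h1).1)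
        obtain ⟨n, hn⟩ := T.reaches_root x hx
        exact key n x hxs hx hn
    · simp only [collapse, hxs, if_false] at hne ⊢
      exact T.parent_mem _ hx hne
  reaches_root := by
    have hroot : collapse s t T.root = T.root := by
      unfold collapse
      split_ifs with hr
      · by_contra hne
        have := (h.2 _ hr (fun e => hne e.symm)).1
        simp [edges] at this
      · rfl
    have key : ∀ n : ℕ, ∀ u ∈ T.verts, T.parent^[n] u = T.root →
        ∃ m : ℕ, (fun u => collapse s t (T.parent u))^[m] (collapse s t u) = T.root := by
      intro n
      induction n with
      | zero =>
        intro u _ hr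
        simp only [Function.iterate_zero, id] at hr
        exact ⟨0, by simp [hr, hroot]⟩
      | succ n ih =>
        intro u hu hr
        by_cases hur : u = T.root
        · exact ⟨0, by simp [hur, hroot]⟩
        obtain ⟨m, hm⟩ := ih _ (T.parent_mem u hu hur) (by rwa [Function.iterate_succ_apply] at hr)
        by_cases hut : u ∈ s ∧ u ≠ t
        · refine ⟨m, ?_⟩
          have h2 := (h.2 _ hut.1 hut.2).2
          simpa [collapse, hut.1, h2] using hm
        · refine ⟨m + 1, ?_⟩
          have hcu : collapse s t u = u := by
            unfold collapse
            split_ifs with hs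
            · by_contra hne
              exact hut ⟨hs, fun e => hne e.symm⟩
            · rfl
          rw [Function.iterate_succ_apply, hcu]
          exact hm
    intro u hu
    obtain ⟨x, hx, rfl⟩ := mem_image.1 hu
    obtain ⟨n, hn⟩ := T.reaches_root x hx
    exact key n x hx hn

/-- The members of a family of subtrees that are minimal by inclusion.  The other members are
unnecessary relations: they follow from the minimal ones. -/
def minimalRels (R : Finset (Finset V)) : Finset (Finset V) :=
  {r ∈ R | ∀ r' ∈ R, r' ⊆ r → r' = r}

/-- The tree `T` with the family `R` of subtrees is an *order*: either `T` is a single corolla, or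
some corolla `v` at the bottom of `T` is contained in a unique minimal subtree `wk` of the
family, and the tree obtained by contracting `wk` to a corolla, with the images of the remaining
minimal subtrees, is again an order. -/
inductive IsOrder : CorollaTree V → Finset (Finset V) → Prop
  | corolla (T : CorollaTree V) (R : Finset (Finset V)) (h : T.edges = ∅) : IsOrder T R
  | step (T : CorollaTree V) (R : Finset (Finset V)) (v : V) (wk : Finset V) (t : V)
      (hv : T.IsBottom v) (hwk : wk ∈ minimalRels R) (hmem : v ∈ wk)
      (huniq : ∀ r ∈ minimalRels R, v ∈ r → r = wk) (ht : T.IsTop wk t)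
      (hnext : IsOrder (T.contract wk t ht)
        (((minimalRels R).erase wk).image fun r => r.image (collapse wk t))) :
      IsOrder T R

/-- The tree monomial with set of corollas `s`, as an element of the monomial operad presented by
the relations `R`: it is zero if and only if it is divisible by a relation, that is, contains
one of the subtrees `r ∈ R`. -/
def Vanishes (R : Finset (Finset V)) (s : Set V) : Prop := ∃ r ∈ R, (r : Set V) ⊆ s

/-- Mark the internal edges in `S` by tensors and the other ones by bullets (the operation is
performed).  This is the set of corollas of the tensor factor of `u`: the corollas that are
joined to `u` by edges marked with bullets. -/
def factor (S : Finset V) (u : V) : Set V :=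
  {v | Relation.EqvGen (fun a b => a ∈ T.edges ∧ a ∉ S ∧ T.parent a = b) u v}

/-- The basis monomials of the bar complex are trees of nonzero elements of the monomial operad
whose full composition is `T`: the tree `T` with a set `S` of internal edges marked by tensors,
such that no tensor factor vanishes in the monomial operad. -/
def IsNonzero (R : Finset (Finset V)) (S : Finset V) : Prop :=
  S ⊆ T.edges ∧ ∀ u ∈ T.verts, ¬ Vanishes R (T.factor S u)

theorem IsNonzero.of_subset {T : CorollaTree V} {R : Finset (Finset V)} {S S' : Finset V}
    (h : T.IsNonzero R S') (hS : S ⊆ T.edges) (hsub : S' ⊆ S) : T.IsNonzero R S := by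
  have key : ∀ a b, Relation.EqvGen (fun a b => a ∈ T.edges ∧ a ∉ S ∧ T.parent a = b) a b →
      Relation.EqvGen (fun a b => a ∈ T.edges ∧ a ∉ S' ∧ T.parent a = b) a b := by
    intro a b hab
    induction hab with
    | rel a b hab => exact .rel _ _ ⟨hab.1, fun h' => hab.2.1 (hsub h'), hab.2.2⟩
    | refl a => exact .refl _
    | symm a b _ ih => exact .symm _ _ ih
    | trans a b c _ _ ih1 ih2 => exact .trans _ _ _ ih1 ih2
  exact ⟨hS, fun u hu ⟨r, hr, hru⟩ => h.2 u hu ⟨r, hr, fun x hx => key u x (hru hx)⟩⟩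

/-- A marked tree vanishes in the monomial operad if and only if all internal edges of some
relation subtree are marked by bullets. -/
theorem isNonzero_iff {R : Finset (Finset V)} (hR : ∀ r ∈ R, T.IsSubtree r) (S : Finset V) :
    T.IsNonzero R S ↔ S ⊆ T.edges ∧ ∀ r ∈ R, ¬ Disjoint (T.edgesIn r) S := by
  refine and_congr_right fun hS => ⟨fun h r hr hd => ?_, fun h u _ ⟨r, hr, hru⟩ => ?_⟩
  · obtain ⟨hrv, t, ht⟩ := hR r hr
    refine h t (hrv ht.1) ⟨r, hr, ?_⟩
    have key : ∀ n : ℕ, ∀ x ∈ r, T.parent^[n] x = T.root → x ∈ T.factor S t := by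
      intro n
      induction n with
      | zero =>
        intro x hx hxr
        by_cases hxt : x = t
        · subst hxt; exact Relation.EqvGen.refl _
        · have := (ht.2 x hx hxt).1
          simp only [Function.iterate_zero, id] at hxr
          simp [edges, hxr] at this
      | succ n ih =>
        intro x hx hxr
        by_cases hxt : x = t
        · subst hxt; exact Relation.EqvGen.refl _
        · obtain ⟨h1, h2⟩ := ht.2 x hx hxt
          have h3 := ih _ h2 (by rwa [Function.iterate_succ_apply] at hxr)
          have h4 : x ∉ S := disjoint_left.1 hd (by simp [edgesIn, hx, h1, h2])
          exact Relation.EqvGen.trans _ _ _ h3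
            (Relation.EqvGen.symm _ _ (Relation.EqvGen.rel _ _ ⟨h1, h4, rfl⟩))
    intro x hx
    obtain ⟨n, hn⟩ := T.reaches_root x (hrv hx)
    exact key n x hx hn
  · refine h r hr (disjoint_left.2 fun e he heS => ?_)
    simp only [edgesIn, mem_filter] at he
    obtain ⟨he1, he2, he3⟩ := he
    have hne : e ≠ T.root := (mem_erase.1 he2).1
    set p : V → V := fun u => if u = T.root then T.root else T.parent u with hp
    have hproot : ∀ n : ℕ, p^[n] T.root = T.root := fun n =>
      Function.iterate_fixed (by simp [hp]) n
    have hreach : ∀ n : ℕ, ∀ u, T.parent^[n] u = T.root → p^[n] u = T.root := by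
      intro n
      induction n with
      | zero => exact fun u hu => hu
      | succ n ih =>
        intro u hu
        by_cases hur : u = T.root
        · rw [hur]; exact hproot _
        · rw [Function.iterate_succ_apply] at hu ⊢
          have : p u = T.parent u := by simp [hp, hur]
          rw [this]
          exact ih _ hu
    have hinv : ∀ a b, Relation.EqvGen
        (fun a b => a ∈ T.edges ∧ a ∉ S ∧ T.parent a = b) a b →
        ((∃ n : ℕ, p^[n] a = e) ↔ ∃ n : ℕ, p^[n] b = e) := by
      intro a b hab
      induction hab with
      | rel a b hab =>
        obtain ⟨h1, h2, rfl⟩ := hab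
        have har : a ≠ T.root := (mem_erase.1 h1).1
        have hpa : p a = T.parent a := by simp [hp, har]
        constructor
        · rintro ⟨n, hn⟩
          cases n with
          | zero => exact absurd (show a = e from hn) (by rintro rfl; exact h2 heS)
          | succ n =>
            rw [Function.iterate_succ_apply, hpa] at hn
            exact ⟨n, hn⟩
        · rintro ⟨n, hn⟩
          exact ⟨n + 1, by rw [Function.iterate_succ_apply, hpa]; exact hn⟩
      | refl a => exact Iff.rfl
      | symm a b _ ih => exact ih.symm
      | trans a b c _ _ ih1 ih2 => exact ih1.trans ih2
    have hj := Relation.EqvGen.trans _ _ _ (Relation.EqvGen.symm _ _ (hru he1)) (hru he3)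
    obtain ⟨m, hm⟩ := (hinv _ _ hj).1 ⟨0, rfl⟩
    have hpe : p e = T.parent e := by simp [hp, hne]
    have hcyc : p^[m + 1] e = e := by rw [Function.iterate_succ_apply, hpe]; exact hm
    obtain ⟨N, hN⟩ := T.reaches_root e (mem_erase.1 he2).2
    have h1 : p^[N] e = T.root := hreach N e hN
    have h2 : p^[(m + 1) * N] e = e := by
      rw [Function.iterate_mul]
      exact Function.iterate_fixed hcyc N
    have h3 : (m + 1) * N = m * N + N := by ring
    rw [h3, Function.iterate_add_apply, h1, hproot] at h2
    exact hne h2.symm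

end CorollaTree

/-- The underlying vector space of the bar subcomplex `B_w`: it has the nonzero marked trees as
a basis, the number of tensors being the degree up to a shift. -/
abbrev BarSpace (k : Type*) [Field k] {V : Type*} [DecidableEq V] (T : CorollaTree V)
    (R : Finset (Finset V)) : Type _ :=
  {S : Finset V // T.IsNonzero R S} →₀ k

section Differential

variable (k : Type*) [Field k] {V : Type*} [LinearOrder V] (T : CorollaTree V)
  (R : Finset (Finset V))

open Classical in
/-- The marked tree with tensors `S` as a vector of the bar complex; it is `0` if the marked tree
vanishes in the monomial operad. -/
noncomputable def barMonomial (S : Finset V) : BarSpace k T R :=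
  if h : T.IsNonzero R S then Finsupp.single ⟨S, h⟩ 1 else 0

/-- The differential replaces one tensor by a bullet, in all possible ways (two neighbouring tensor
factors are composed in the monomial operad), with the Koszul sign given by the number of tensors
that precede the replaced one. -/
noncomputable def barDifferential : BarSpace k T R →ₗ[k] BarSpace k T R :=
  Finsupp.linearCombination k fun S : {S : Finset V // T.IsNonzero R S} =>
    ∑ e ∈ S.1, (-1 : k) ^ (#{f ∈ S.1 | f < e}) • barMonomial k T R (S.1.erase e)

theorem barDifferential_barMonomial (S : Finset V) (hS : S ⊆ T.edges) :
    barDifferential k T R (barMonomial k T R S) =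
      ∑ e ∈ S, (-1 : k) ^ (#{f ∈ S | f < e}) • barMonomial k T R (S.erase e) := by
  by_cases h : T.IsNonzero R S
  · simp [barMonomial, h, barDifferential]
  · have h0 : ∀ e, ¬ T.IsNonzero R (S.erase e) := by
      intro e he
      exact h (he.of_subset hS (erase_subset _ _))
    simp [barMonomial, h, h0]

/-- The differential squares to zero. -/
theorem barDifferential_comp_self :
    barDifferential k T R ∘ₗ barDifferential k T R = 0 := by
  refine Finsupp.lhom_ext' fun S => LinearMap.ext_ring ?_
  obtain ⟨S, hS⟩ := S
  have h1 : Finsupp.single (⟨S, hS⟩ : {S : Finset V // T.IsNonzero R S}) (1 : k) =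
      barMonomial k T R S := by simp [barMonomial, hS]
  simp only [LinearMap.comp_apply, Finsupp.lsingle_apply, LinearMap.zero_apply]
  rw [h1, barDifferential_barMonomial k T R S hS.1, map_sum]
  have h2 : ∀ e ∈ S, barDifferential k T R
      ((-1 : k) ^ (#{f ∈ S | f < e}) • barMonomial k T R (S.erase e)) =
      ∑ f ∈ S.erase e, ((-1 : k) ^ (#{f ∈ S | f < e}) * (-1 : k) ^ (#{g ∈ S.erase e | g < f})) •
        barMonomial k T R ((S.erase e).erase f) := by
    intro e _
    rw [map_smul, barDifferential_barMonomial k T R _ ((erase_subset _ _).trans hS.1), smul_sum]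
    simp only [smul_smul]
  rw [sum_congr rfl h2, sum_sigma']
  refine sum_involution (fun p _ => ⟨p.2, p.1⟩) ?_ ?_ ?_ ?_
  · rintro ⟨e, f⟩ hp
    simp only [mem_sigma, mem_erase] at hp
    obtain ⟨he, hfe, hf⟩ := hp
    dsimp only
    rw [erase_right_comm (a := f) (b := e), ← add_smul]
    have cnt : ∀ a b : V, a ∈ S → a < b →
        #{g ∈ S | g < b} = #{g ∈ S.erase a | g < b} + 1 := by
      intro a b ha hab
      rw [filter_erase, card_erase_add_one]
      simp [ha, hab]
    have cnt' : ∀ a b : V, ¬ a < b → #{g ∈ S | g < b} = #{g ∈ S.erase a | g < b} := by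
      intro a b hab
      rw [filter_erase, erase_eq_of_notMem]
      simp [hab]
    convert zero_smul k _
    rcases lt_or_gt_of_ne hfe with hlt | hlt
    · rw [cnt f e hf hlt, cnt' e f hlt.asymm]
      ring
    · rw [cnt e f he hlt, cnt' f e hlt.asymm]
      ring
  · rintro ⟨e, f⟩ hp _ heq
    simp only [mem_sigma, mem_erase] at hp
    simp only [Sigma.mk.injEq, heq_eq_eq] at heq
    exact hp.2.1 heq.1
  · rintro ⟨e, f⟩ hp
    simp only [mem_sigma, mem_erase] at hp ⊢
    exact ⟨hp.2.2, fun h => hp.2.1 h.symm, hp.1⟩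
  · rintro ⟨e, f⟩ _
    rfl

end Differential

/-- The full homology `Ker D / Im D` of a vector space with a differential `D`. -/
abbrev TotalHomology {k : Type*} [Field k] {M : Type*} [AddCommGroup M] [Module k M]
    (D : M →ₗ[k] M) : Type _ :=
  LinearMap.ker D ⧸ (LinearMap.range D).submoduleOf (LinearMap.ker D)

/-! Let `s` be the only minimal relation through the corolla `v`. If `s` is the single corolla `v`,
every marking vanishes and the complex is zero. Otherwise `s` has an internal edge `e` at `v`. A
relation containing `e` contains both its ends, hence `v`, so `e` lies in no other minimal relation.
Pair each marking `S` without a tensor at `e` with `insert e S`. Pairs with both members nonzero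
cancel. What is left are the nonzero `insert e S` with `S` vanishing. Since only `s` sees `e`, these
are the `S` with bullets on all of `s` and with a tensor in every other minimal relation, that is,
the nonzero markings of the tree with `s` contracted (`isNonzero_contract_iff`). The leftover
markings span a subcomplex, a shifted copy of the bar complex of the contracted tree
(`barInsert_comm`), and inserting a tensor at `e` is a homotopy that pushes every cycle into it
modulo boundaries (`barHomotopy_defect`). Hence the bound passes from the contracted tree to `w`
(`HasCyclicHomology.of_homotopy`), and induction along the order ends at a single corolla. -/

namespace CorollaTree

/-! ### Paths to the root and convexity of subtrees -/

variable {V : Type*} [DecidableEq V] (T : CorollaTree V)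

/-- `T.Below a b`: the corolla `b` lies on the path from `a` to the root. -/
def Below : V → V → Prop :=
  Relation.ReflTransGen fun a b => a ∈ T.edges ∧ T.parent a = b

variable {T}

theorem mem_edges {u : V} : u ∈ T.edges ↔ u ≠ T.root ∧ u ∈ T.verts := mem_erase

variable (T) in
-- The depth is the first time the path of parents meets the root, which makes it independent of the
-- junk value of `parent` there. It serves as a rank for inductions and excludes cycles.
theorem exists_depth : ∃ d : V → ℕ, ∀ u ∈ T.edges, d (T.parent u) < d u := by
  refine ⟨fun u => sInf {n | T.parent^[n] u = T.root}, fun u hu => ?_⟩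
  obtain ⟨hur, huv⟩ := mem_edges.1 hu
  have hne : {n | T.parent^[n] u = T.root}.Nonempty := T.reaches_root u huv
  have hmem : T.parent^[sInf {n | T.parent^[n] u = T.root}] u = T.root := Nat.sInf_mem hne
  change sInf _ < sInf {n | T.parent^[n] u = T.root}
  cases hd : sInf {n | T.parent^[n] u = T.root} with
  | zero => rw [hd] at hmem; exact absurd hmem hur
  | succ m =>
    rw [hd, Function.iterate_succ_apply] at hmem
    exact Nat.lt_succ_of_le (Nat.sInf_le hmem)

theorem Below.eq_or_depth_lt {d : V → ℕ} (hd : ∀ u ∈ T.edges, d (T.parent u) < d u) {a b : V}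
    (h : T.Below a b) : a = b ∨ d b < d a := by
  induction h with
  | refl => exact .inl rfl
  | tail _ hbc ih =>
    obtain ⟨hb, rfl⟩ := hbc
    rcases ih with rfl | ih
    · exact .inr (hd _ hb)
    · exact .inr ((hd _ hb).trans ih)

theorem not_below_parent {u : V} (hu : u ∈ T.edges) : ¬ T.Below (T.parent u) u := by
  intro h
  obtain ⟨d, hd⟩ := T.exists_depth
  have h1 := hd u hu
  rcases h.eq_or_depth_lt hd with h | h
  · rw [h] at h1; omega
  · omega

theorem below_parent {u : V} (hu : u ∈ T.edges) : T.Below u (T.parent u) :=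
  Relation.ReflTransGen.single ⟨hu, rfl⟩

theorem Below.total {a b c : V} (h : T.Below a b) (h' : T.Below a c) :
    T.Below b c ∨ T.Below c b :=
  Relation.ReflTransGen.total_of_right_unique (fun _ _ _ h1 h2 => h1.2.symm.trans h2.2) h h'

theorem IsTop.below {s : Finset V} {t x : V} (h : T.IsTop s t) (hx : x ∈ s) : T.Below x t := by
  obtain ⟨d, hd⟩ := T.exists_depth
  induction hn : d x using Nat.strong_induction_on generalizing x with
  | _ n ih =>
    by_cases hxt : x = t
    · subst hxt; exact Relation.ReflTransGen.refl
    · obtain ⟨h1, h2⟩ := h.2 x hx hxt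
      exact (below_parent h1).trans (ih _ (hn ▸ hd x h1) h2 rfl)

/-- Convexity: a path can leave `s` only through its top `t`, and once past `t` it cannot come back,
since `q` itself lies below `t` and the tree has no cycles. -/
theorem IsTop.mem_of_below {s : Finset V} {t x u q : V} (h : T.IsTop s t) (hx : x ∈ s)
    (hq : q ∈ s) (hxu : T.Below x u) (huq : T.Below u q) : u ∈ s := by
  induction hxu using Relation.ReflTransGen.head_induction_on with
  | refl => exact hx
  | head hac hcu ih =>
    rename_i a c
    obtain ⟨ha, rfl⟩ := hac
    by_cases hat : a = t
    · subst hat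
      exact absurd (hcu.trans (huq.trans (h.below hq))) (not_below_parent ha)
    · exact ih (h.2 a hx hat).2

theorem IsTop.parent_notMem {s : Finset V} {t : V} (h : T.IsTop s t) (ht : t ∈ T.edges) :
    T.parent t ∉ s := fun hp => not_below_parent ht (h.below hp)

theorem IsTop.mem_edgesIn {s : Finset V} {t u : V} (h : T.IsTop s t) :
    u ∈ T.edgesIn s ↔ u ∈ s ∧ u ≠ t := by
  simp only [edgesIn, mem_filter]
  refine and_congr_right fun hu => ⟨?_, h.2 u hu⟩
  rintro ⟨h1, h2⟩ rfl
  exact h.parent_notMem h1 h2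

/-- A subtree containing `v` either is the single corolla `v` or has an internal edge at `v`. -/
theorem IsTop.exists_edge {s : Finset V} {t v : V} (h : T.IsTop s t) (hv : v ∈ s) :
    s = {v} ∨ ∃ e ∈ T.edgesIn s, e = v ∨ T.parent e = v := by
  by_cases hvt : v = t
  · subst hvt
    by_cases hs : s = {v}
    · exact .inl hs
    right
    obtain ⟨x, hx, hxv⟩ : ∃ x ∈ s, x ≠ v := by
      by_contra! hcon
      exact hs (eq_singleton_iff_unique_mem.2 ⟨hv, hcon⟩)
    -- The last edge of the path from `x` up to the top `v` lies inside `s` by convexity.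
    rcases (Relation.ReflTransGen.cases_tail_iff _ _ _).1 (h.below hx) with h1 | ⟨c, hxc, hc, hcv⟩
    · exact absurd h1.symm hxv
    · refine ⟨c, h.mem_edgesIn.2 ⟨h.mem_of_below hx hv hxc (hcv ▸ below_parent hc), ?_⟩, .inr hcv⟩
      rintro rfl
      exact h.parent_notMem hc (hcv.symm ▸ hv)
  · exact .inr ⟨v, h.mem_edgesIn.2 ⟨hv, hvt⟩, .inl rfl⟩

theorem edgesIn_mono {r s : Finset V} (h : r ⊆ s) : T.edgesIn r ⊆ T.edgesIn s := by
  intro u hu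
  simp only [edgesIn, mem_filter] at hu ⊢
  exact ⟨h hu.1, hu.2.1, h hu.2.2⟩

theorem edgesIn_subset (s : Finset V) : T.edgesIn s ⊆ T.edges := by
  intro u hu
  simp only [edgesIn, mem_filter] at hu
  exact hu.2.1

/-! ### Minimal relations -/

theorem minimalRels_subset (R : Finset (Finset V)) : minimalRels R ⊆ R := filter_subset _ _

theorem exists_minimalRels_subset {R : Finset (Finset V)} {r : Finset V} (hr : r ∈ R) :
    ∃ r' ∈ minimalRels R, r' ⊆ r := by
  obtain ⟨m, hmr, hm⟩ := R.exists_le_minimal hr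
  refine ⟨m, mem_filter.2 ⟨hm.1, fun r' hr' h => ?_⟩, hmr⟩
  exact le_antisymm h (hm.2 hr' h)

/-- Only the minimal relations matter. -/
theorem isNonzero_iff_minimalRels {R : Finset (Finset V)} (hR : ∀ r ∈ R, T.IsSubtree r)
    (S : Finset V) :
    T.IsNonzero R S ↔ S ⊆ T.edges ∧ ∀ r ∈ minimalRels R, ¬ Disjoint (T.edgesIn r) S := by
  rw [T.isNonzero_iff hR]
  refine and_congr_right fun _ => ⟨fun h r hr => h r (minimalRels_subset R hr), fun h r hr => ?_⟩
  obtain ⟨r', hr', hsub⟩ := exists_minimalRels_subset hr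
  exact fun hd => h r' hr' (hd.mono_left (edgesIn_mono hsub))

/-! ### Contraction of a subtree -/

theorem collapse_of_mem {s : Finset V} {t u : V} (h : u ∈ s) : collapse s t u = t := if_pos h

theorem collapse_of_notMem {s : Finset V} {t u : V} (h : u ∉ s) : collapse s t u = u := if_neg h

theorem collapse_eq_self {s : Finset V} {t u : V} (h : u ∈ s → u = t) : collapse s t u = u := by
  unfold collapse
  split_ifs with hu
  · exact (h hu).symm
  · rfl

/-- The new corolla keeps the name of the top `t`, so surviving edges keep their names and exactly
the edges inside `s` are lost. -/
theorem mem_edges_contract {s : Finset V} {t u : V} (h : T.IsTop s t) (hs : s ⊆ T.verts) :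
    u ∈ (T.contract s t h).edges ↔ u ∈ T.edges ∧ (u ∈ s → u = t) := by
  rw [mem_edges, mem_edges]
  change u ≠ T.root ∧ u ∈ T.verts.image (collapse s t) ↔ _
  rw [and_assoc]
  refine and_congr_right fun _ => ?_
  rw [mem_image]
  constructor
  · rintro ⟨x, hx, rfl⟩
    by_cases hxs : x ∈ s
    · rw [collapse_of_mem hxs]; exact ⟨hs h.1, fun _ => rfl⟩
    · rw [collapse_of_notMem hxs]; exact ⟨hx, fun h' => absurd h' hxs⟩
  · rintro ⟨hu, hut⟩
    exact ⟨u, hu, collapse_eq_self hut⟩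

theorem IsSubtree.image_collapse {s r : Finset V} {t : V} (h : T.IsTop s t) (hs : s ⊆ T.verts)
    (hr : T.IsSubtree r) : (T.contract s t h).IsSubtree (r.image (collapse s t)) := by
  obtain ⟨hrv, q, hq⟩ := hr
  refine ⟨image_subset_image hrv, collapse s t q, mem_image_of_mem _ hq.1, ?_⟩
  intro z hz hzq
  obtain ⟨x, hx, rfl⟩ := mem_image.1 hz
  rw [mem_edges_contract h hs]
  change _ ∧ collapse s t (T.parent (collapse s t x)) ∈ _
  by_cases hxt : x ∈ s → x = t
  · rw [collapse_eq_self hxt] at hzq ⊢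
    have hxq : x ≠ q := by
      rintro rfl
      exact hzq (collapse_eq_self hxt).symm
    obtain ⟨h1, h2⟩ := hq.2 x hx hxq
    exact ⟨⟨h1, hxt⟩, mem_image_of_mem _ h2⟩
  · obtain ⟨hxs, -⟩ := Classical.not_imp.1 hxt
    rw [collapse_of_mem hxs] at hzq ⊢
    have hqs : q ∉ s := fun hqs => hzq (collapse_of_mem hqs).symm
    rw [collapse_of_notMem hqs] at hzq
    -- The path from `x` to `q` starts in `s` and ends outside it, so it passes through `t`, which
    -- puts `t` in `r`.
    have htq : T.Below t q := by
      refine ((h.below hxs).total (hq.below hx)).resolve_right fun hqt => hqs ?_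
      exact h.mem_of_below hxs h.1 (hq.below hx) hqt
    have htr : t ∈ r := hq.mem_of_below hx hq.1 (h.below hxs) htq
    obtain ⟨h1, h2⟩ := hq.2 t htr hzq
    exact ⟨⟨h1, fun _ => rfl⟩, mem_image_of_mem _ h2⟩

/-- The point is that collapsing gives `r` no new edge. When `r` meets `s`, an edge outside `s`
whose ends only become ends in the image of `r` would contradict convexity of `r` or of `s`. -/
theorem edgesIn_contract {s r : Finset V} {t : V} (h : T.IsTop s t) (hs : s ⊆ T.verts)
    (hr : T.IsSubtree r) :
    (T.contract s t h).edgesIn (r.image (collapse s t)) = T.edgesIn r \ T.edgesIn s := by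
  obtain ⟨hrv, q, hq⟩ := hr
  ext u
  rw [mem_sdiff, h.mem_edgesIn, not_and_not_right]
  simp only [edgesIn, mem_filter]
  rw [mem_edges_contract h hs]
  change _ ∧ _ ∧ collapse s t (T.parent u) ∈ _ ↔ _
  constructor
  · rintro ⟨hu, ⟨huE, hut⟩, hp⟩
    obtain ⟨x, hx, hxu⟩ := mem_image.1 hu
    obtain ⟨y, hy, hyp⟩ := mem_image.1 hp
    refine ⟨?_, hut⟩
    by_cases hur : u ∈ r
    · refine ⟨hur, huE, ?_⟩
      by_cases huq : u = q
      · subst huq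
        by_contra hpr
        have hne : y ≠ T.parent u := by rintro rfl; exact hpr hy
        have hps : T.parent u ∈ s := by
          by_contra hps
          rw [collapse_of_notMem hps] at hyp
          by_cases hys : y ∈ s
          · rw [collapse_of_mem hys] at hyp; exact hps (hyp ▸ h.1)
          · rw [collapse_of_notMem hys] at hyp; exact hne hyp
        have hys : y ∈ s := by
          by_contra hys
          rw [collapse_of_notMem hys, collapse_of_mem hps] at hyp
          exact hys (hyp ▸ h.1)
        have hus : u ∈ s := h.mem_of_below hys hps (hq.below hy) (below_parent huE)
        obtain rfl := hut hus
        exact h.parent_notMem huE hps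
      · exact (hq.2 u hur huq).2
    · have hxs : x ∈ s := by
        by_contra hxs
        rw [collapse_of_notMem hxs] at hxu
        exact hur (hxu ▸ hx)
      rw [collapse_of_mem hxs] at hxu
      subst hxu
      have hps := h.parent_notMem huE
      rw [collapse_of_notMem hps] at hyp
      have hys : y ∉ s := by
        intro hys
        rw [collapse_of_mem hys] at hyp
        exact hps (hyp ▸ h.1)
      rw [collapse_of_notMem hys] at hyp
      exact absurd (hq.mem_of_below hx (hyp ▸ hy) (h.below hxs) (below_parent huE)) hur
  · rintro ⟨⟨hu, huE, hp⟩, hut⟩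
    exact ⟨mem_image.2 ⟨u, hu, collapse_eq_self hut⟩, ⟨huE, hut⟩, mem_image_of_mem _ hp⟩

/-- If the internal edge `e` lies in no minimal relation but `s`, then the marked trees that do not
vanish after contracting `s` are those that vanish but stop vanishing when `e` becomes a tensor. -/
theorem isNonzero_contract_iff {R : Finset (Finset V)} (hR : ∀ r ∈ R, T.IsSubtree r)
    {s : Finset V} {t e : V} (h : T.IsTop s t) (hs : s ∈ minimalRels R) (he : e ∈ T.edgesIn s)
    (huniq : ∀ r ∈ minimalRels R, e ∈ T.edgesIn r → r = s) (S : Finset V) :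
    (T.contract s t h).IsNonzero
        (((minimalRels R).erase s).image fun r => r.image (collapse s t)) S ↔
      e ∉ S ∧ ¬ T.IsNonzero R S ∧ T.IsNonzero R (insert e S) := by
  have hmin : ∀ r ∈ minimalRels R, T.IsSubtree r := fun r hr => hR r (minimalRels_subset R hr)
  have hsv : s ⊆ T.verts := (hmin s hs).1
  have hR' : ∀ r' ∈ ((minimalRels R).erase s).image fun r => r.image (collapse s t),
      (T.contract s t h).IsSubtree r' := by
    intro r' hr'
    obtain ⟨r, hr, rfl⟩ := mem_image.1 hr'
    exact (hmin r (mem_of_mem_erase hr)).image_collapse h hsv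
  have hedges : S ⊆ (T.contract s t h).edges ↔ S ⊆ T.edges ∧ Disjoint (T.edgesIn s) S := by
    rw [disjoint_right]
    simp only [subset_iff, mem_edges_contract h hsv, h.mem_edgesIn, not_and_not_right]
    exact ⟨fun H => ⟨fun _ hx => (H hx).1, fun _ hx => (H hx).2⟩,
      fun H x hx => ⟨H.1 hx, H.2 hx⟩⟩
  rw [isNonzero_iff _ hR', hedges, isNonzero_iff_minimalRels hR, isNonzero_iff_minimalRels hR]
  simp only [forall_mem_image, mem_erase, and_imp]
  -- A tensor at `e` can rescue only the relation `s`.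
  have hins : ∀ r ∈ minimalRels R, r ≠ s →
      (Disjoint (T.edgesIn r) (insert e S) ↔ Disjoint (T.edgesIn r) S) := by
    intro r hr hrs
    rw [disjoint_insert_right]
    exact and_iff_right fun her => hrs (huniq r hr her)
  constructor
  · rintro ⟨⟨hSE, hd⟩, H⟩
    refine ⟨fun heS => disjoint_left.1 hd he heS, fun H' => H'.2 s hs hd,
      insert_subset (edgesIn_subset s he) hSE, fun r hr => ?_⟩
    by_cases hrs : r = s
    · subst hrs
      exact fun hd' => disjoint_left.1 hd' he (mem_insert_self _ _)
    · rw [hins r hr hrs]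
      have := H hrs hr
      rw [edgesIn_contract h hsv (hmin r hr)] at this
      exact fun hd' => this (hd'.mono_left sdiff_subset)
  · rintro ⟨heS, hnot, hES, H⟩
    have hSE : S ⊆ T.edges := (subset_insert _ _).trans hES
    -- All other relations already have a tensor in `S`, so `s` is the one that makes `S` vanish.
    have hd : Disjoint (T.edgesIn s) S := by
      by_contra hd
      refine hnot ⟨hSE, fun r hr => ?_⟩
      by_cases hrs : r = s
      · exact hrs ▸ hd
      · exact fun h' => H r hr ((hins r hr hrs).2 h')
    refine ⟨⟨hSE, hd⟩, fun r hrs hr => ?_⟩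
    rw [edgesIn_contract h hsv (hmin r hr)]
    intro hd'
    refine H r hr ((hins r hr hrs).2 (disjoint_left.2 fun x hx hxS => ?_))
    exact disjoint_left.1 hd' (mem_sdiff.2 ⟨hx, fun hxs => disjoint_left.1 hd hxs hxS⟩) hxS

end CorollaTree

/-! ### Homology of dimension at most one and its transfer -/

section HomologyBound

/-- Modulo boundaries, the cycles are spanned by a single cycle. -/
def HasCyclicHomology {k M : Type*} [Field k] [AddCommGroup M] [Module k M] (D : M →ₗ[k] M) :
    Prop :=
  ∃ c, D c = 0 ∧ ∀ x, D x = 0 → ∃ (a : k) (y : M), x = a • c + D y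

theorem HasCyclicHomology.rank_totalHomology {k M : Type*} [Field k] [AddCommGroup M] [Module k M]
    {D : M →ₗ[k] M} (h : HasCyclicHomology D) :
    Module.rank k (TotalHomology D) = 0 ∨ Module.rank k (TotalHomology D) = 1 := by
  obtain ⟨c, hc, H⟩ := h
  have hle : Module.rank k (TotalHomology D) ≤ 1 := by
    rw [rank_le_one_iff]
    refine ⟨Submodule.Quotient.mk ⟨c, hc⟩, fun v => ?_⟩
    obtain ⟨⟨x, hx⟩, rfl⟩ := Submodule.Quotient.mk_surjective _ v
    obtain ⟨a, y, hxy⟩ := H x hx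
    refine ⟨a, ?_⟩
    rw [← Submodule.Quotient.mk_smul, eq_comm, Submodule.Quotient.eq, Submodule.submoduleOf, Submodule.mem_comap]
    exact ⟨y, by simp [hxy]⟩
  rcases hle.lt_or_eq with h | h
  · exact .inl (Cardinal.lt_one_iff.1 h)
  · exact .inr h

/-- Comparison of homologies along a chain map `i` whose range contains all the defects
`x - D (h x) - h (D x)` of a homotopy `h`, and which is injective. -/
theorem HasCyclicHomology.of_homotopy {k M N : Type*} [Field k] [AddCommGroup M] [Module k M]
    [AddCommGroup N] [Module k N] {D : M →ₗ[k] M} {D' : N →ₗ[k] N} (i : N →ₗ[k] M)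
    (h : M →ₗ[k] M) (hi : Function.Injective i) (hD : D ∘ₗ D = 0) (hcomm : D ∘ₗ i = i ∘ₗ D')
    (hh : ∀ x, x - D (h x) - h (D x) ∈ LinearMap.range i) (hN : HasCyclicHomology D') :
    HasCyclicHomology D := by
  obtain ⟨c, hc, H⟩ := hN
  have hcomm' : ∀ z, D (i z) = i (D' z) := fun z => LinearMap.congr_fun hcomm z
  refine ⟨i c, by rw [hcomm', hc, map_zero], fun x hx => ?_⟩
  obtain ⟨z, hz⟩ := hh x
  rw [hx, map_zero, sub_zero] at hz
  have hDD : D (D (h x)) = 0 := LinearMap.congr_fun hD (h x)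
  -- Here `i z = x - D (h x)` is a cycle, and injectivity of `i` makes `z` one.
  have hz0 : D' z = 0 := by
    apply hi
    rw [← hcomm', hz, map_sub, hx, hDD, map_zero, sub_zero]
  obtain ⟨a, y, rfl⟩ := H z hz0
  refine ⟨a, h x + i y, ?_⟩
  rw [map_add, hcomm', add_left_comm, ← map_smul, ← map_add, hz, add_sub_cancel]

end HomologyBound

/-! ### Koszul signs -/

section BarComplex

variable {k : Type*} [Field k] {V : Type*} [LinearOrder V]

/-- The Koszul sign of the position `e` in `S`. -/
def koszulSign (k : Type*) [Field k] (S : Finset V) (e : V) : k := (-1) ^ #{f ∈ S | f < e}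

/-- The sign of moving a tensor at `e` past all the tensors of `S` that follow it. -/
def followSign (k : Type*) [Field k] (e : V) (S : Finset V) : k := (-1) ^ #{f ∈ S | e < f}

theorem koszulSign_mul_self (S : Finset V) (e : V) : koszulSign k S e * koszulSign k S e = 1 := by
  rw [koszulSign, ← mul_pow]; simp

theorem followSign_mul_self (S : Finset V) (e : V) : followSign k e S * followSign k e S = 1 := by
  rw [followSign, ← mul_pow]; simp

theorem koszulSign_insert_self (S : Finset V) (e : V) :
    koszulSign k (insert e S) e = koszulSign k S e := by
  simp [koszulSign, filter_insert]

theorem koszulSign_erase_self (S : Finset V) (e : V) :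
    koszulSign k (S.erase e) e = koszulSign k S e := by
  rw [koszulSign, koszulSign, filter_erase, erase_eq_of_notMem (by simp)]

theorem koszulSign_insert {S : Finset V} {e : V} (he : e ∉ S) (f : V) :
    koszulSign k (insert e S) f = (if e < f then -1 else 1) * koszulSign k S f := by
  rw [koszulSign, koszulSign, filter_insert]
  split_ifs
  · rw [card_insert_of_notMem (by simp [he]), pow_succ']
  · rw [one_mul]

theorem koszulSign_of_mem {S : Finset V} {f : V} (hf : f ∈ S) (e : V) :
    koszulSign k S e = (if f < e then -1 else 1) * koszulSign k (S.erase f) e := by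
  rw [← koszulSign_insert (notMem_erase f S), insert_erase hf]

theorem followSign_of_mem {S : Finset V} {f : V} (hf : f ∈ S) (e : V) :
    followSign k e S = (if e < f then -1 else 1) * followSign k e (S.erase f) := by
  conv_lhs => rw [← insert_erase hf]
  rw [followSign, followSign, filter_insert]
  split_ifs
  · rw [card_insert_of_notMem (by simp), pow_succ']
  · rw [one_mul]

/-- Whichever of `e`, `f` comes first changes the sign of the other. This cancels the mixed terms in
the homotopy formula. -/
theorem koszulSign_add_eq_zero {S : Finset V} {e f : V} (he : e ∉ S) (hf : f ∈ S) :
    koszulSign k S e * koszulSign k (insert e S) f +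
      koszulSign k S f * koszulSign k (S.erase f) e = 0 := by
  rw [koszulSign_insert he, koszulSign_of_mem hf e]
  rcases lt_or_gt_of_ne (ne_of_mem_of_not_mem hf he) with h | h
  · rw [if_pos h, if_neg h.asymm]; ring
  · rw [if_pos h, if_neg h.asymm]; ring

/-- A tensor at `e` changes the sign of `f` exactly when `f` follows `e`. Counting the followers of
`e` absorbs this, so insertion commutes with the differential with no extra sign. -/
theorem followSign_mul_koszulSign {S : Finset V} {e f : V} (he : e ∉ S) (hf : f ∈ S) :
    followSign k e S * koszulSign k (insert e S) f =
      koszulSign k S f * followSign k e (S.erase f) := by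
  rw [koszulSign_insert he, followSign_of_mem hf e]
  split_ifs <;> ring

/-! ### Linear maps on the bar complex -/

variable {T : CorollaTree V} {R : Finset (Finset V)}

theorem barMonomial_of_isNonzero {S : Finset V} (h : T.IsNonzero R S) :
    barMonomial k T R S = Finsupp.single ⟨S, h⟩ 1 := dif_pos h

theorem barMonomial_of_not_isNonzero {S : Finset V} (h : ¬ T.IsNonzero R S) :
    barMonomial k T R S = 0 := dif_neg h

theorem barDifferential_barMonomial_sign {S : Finset V} (hS : S ⊆ T.edges) :
    barDifferential k T R (barMonomial k T R S) =
      ∑ f ∈ S, koszulSign k S f • barMonomial k T R (S.erase f) :=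
  barDifferential_barMonomial k T R S hS

theorem bar_induction {p : BarSpace k T R → Prop} (h0 : p 0) (hadd : ∀ x y, p x → p y → p (x + y))
    (hsmul : ∀ (a : k) x, p x → p (a • x))
    (hmon : ∀ S, T.IsNonzero R S → p (barMonomial k T R S)) (x : BarSpace k T R) : p x := by
  induction x using Finsupp.induction_linear with
  | zero => exact h0
  | add x y hx hy => exact hadd x y hx hy
  | single S a =>
    have := hsmul a _ (hmon S.1 S.2)
    rwa [barMonomial_of_isNonzero S.2, Finsupp.smul_single, smul_eq_mul, mul_one] at this

theorem bar_linearMap_ext {M : Type*} [AddCommGroup M] [Module k M] {f g : BarSpace k T R →ₗ[k] M}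
    (h : ∀ S, T.IsNonzero R S → f (barMonomial k T R S) = g (barMonomial k T R S)) : f = g := by
  refine LinearMap.ext fun x => ?_
  induction x using bar_induction with
  | h0 => simp
  | hadd x y hx hy => rw [map_add, map_add, hx, hy]
  | hsmul a x hx => rw [map_smul, map_smul, hx]
  | hmon S hS => exact h S hS

/-- The linear map defined on the bar complex by its values on monomials. -/
noncomputable def barLift {M : Type*} [AddCommGroup M] [Module k M] (T : CorollaTree V)
    (R : Finset (Finset V)) (φ : Finset V → M) : BarSpace k T R →ₗ[k] M :=
  Finsupp.linearCombination k fun S : {S : Finset V // T.IsNonzero R S} => φ S.1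

theorem barLift_barMonomial {M : Type*} [AddCommGroup M] [Module k M] (φ : Finset V → M)
    {S : Finset V} (h : T.IsNonzero R S) : barLift T R φ (barMonomial k T R S) = φ S := by
  simp [barLift, barMonomial_of_isNonzero h]

variable (k T R) in
/-- The homotopy that turns the bullet at `e` into a tensor. -/
noncomputable def barHomotopy (e : V) : BarSpace k T R →ₗ[k] BarSpace k T R :=
  barLift T R fun S => if e ∈ S then 0 else koszulSign k S e • barMonomial k T R (insert e S)

/-- Multiplication by a tensor at `e`, from the bar complex of `(T', R')` to that of `(T, R)`. -/
noncomputable def barInsert (k : Type*) [Field k] (T' T : CorollaTree V) (R' R : Finset (Finset V))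
    (e : V) : BarSpace k T' R' →ₗ[k] BarSpace k T R :=
  barLift T' R' fun S => followSign k e S • barMonomial k T R (insert e S)

/-! ### Reduction to the contracted tree -/

variable {T' : CorollaTree V} {R' : Finset (Finset V)} {e : V}

theorem barInsert_injective
    (h : ∀ S, T'.IsNonzero R' S → e ∉ S ∧ T.IsNonzero R (insert e S)) :
    Function.Injective (barInsert k T' T R' R e) := by
  let p : BarSpace k T R →ₗ[k] BarSpace k T' R' :=
    barLift T R fun S => followSign k e (S.erase e) • barMonomial k T' R' (S.erase e)
  have hp : p ∘ₗ barInsert k T' T R' R e = LinearMap.id := by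
    refine bar_linearMap_ext fun S hS => ?_
    obtain ⟨heS, hnz⟩ := h S hS
    rw [LinearMap.comp_apply, barInsert, barLift_barMonomial _ hS, map_smul,
      barLift_barMonomial _ hnz, erase_insert heS, smul_smul, followSign_mul_self, one_smul,
      LinearMap.id_apply]
  exact Function.LeftInverse.injective (g := p) (LinearMap.congr_fun hp)

/-- The term of the differential at `e` itself is zero because `S` vanishes in `T`. The other terms
match: `S.erase f` still vanishes in `T`, so it survives in `T'` precisely when `insert e (S.erase
f)` survives in `T`. -/
theorem barInsert_comm
    (h : ∀ S, T'.IsNonzero R' S ↔ e ∉ S ∧ ¬ T.IsNonzero R S ∧ T.IsNonzero R (insert e S)) :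
    barDifferential k T R ∘ₗ barInsert k T' T R' R e =
      barInsert k T' T R' R e ∘ₗ barDifferential k T' R' := by
  refine bar_linearMap_ext fun S hS => ?_
  obtain ⟨heS, hn, hnz⟩ := (h S).1 hS
  have hSE : S ⊆ T.edges := (subset_insert _ _).trans hnz.1
  rw [LinearMap.comp_apply, LinearMap.comp_apply, barDifferential_barMonomial_sign hS.1, barInsert,
    barLift_barMonomial _ hS, map_smul, barDifferential_barMonomial_sign hnz.1, sum_insert heS,
    erase_insert heS, barMonomial_of_not_isNonzero hn, smul_zero, zero_add, smul_sum, map_sum]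
  refine sum_congr rfl fun f hf => ?_
  have hef : e ∉ S.erase f := fun h' => heS (mem_of_mem_erase h')
  rw [smul_smul, followSign_mul_koszulSign heS hf, map_smul, mul_smul,
    erase_insert_of_ne (ne_of_mem_of_not_mem hf heS).symm]
  congr 1
  by_cases hf' : T'.IsNonzero R' (S.erase f)
  · rw [barLift_barMonomial _ hf']
  · have : ¬ T.IsNonzero R (insert e (S.erase f)) := fun h' => hf' ((h _).2
      ⟨hef, fun h'' => hn (h''.of_subset hSE (erase_subset _ _)), h'⟩)
    rw [barMonomial_of_not_isNonzero hf', barMonomial_of_not_isNonzero this, smul_zero, map_zero]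

theorem barHomotopy_defect (he : e ∈ T.edges)
    (h : ∀ S, e ∉ S → ¬ T.IsNonzero R S → T.IsNonzero R (insert e S) → T'.IsNonzero R' S)
    (x : BarSpace k T R) :
    x - barDifferential k T R (barHomotopy k T R e x) -
      barHomotopy k T R e (barDifferential k T R x) ∈
        LinearMap.range (barInsert k T' T R' R e) := by
  have hrange : ∀ S, e ∉ S → ¬ T.IsNonzero R S →
      barMonomial k T R (insert e S) ∈ LinearMap.range (barInsert k T' T R' R e) := by
    intro S heS hn
    by_cases hnz : T.IsNonzero R (insert e S)
    · refine ⟨followSign k e S • barMonomial k T' R' S, ?_⟩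
      rw [map_smul, barInsert, barLift_barMonomial _ (h S heS hn hnz), smul_smul,
        followSign_mul_self, one_smul]
    · rw [barMonomial_of_not_isNonzero hnz]; exact Submodule.zero_mem _
  have hmem : ∀ S, e ∈ S → barHomotopy k T R e (barMonomial k T R S) = 0 := by
    intro S heS
    by_cases hS : T.IsNonzero R S
    · rw [barHomotopy, barLift_barMonomial _ hS, if_pos heS]
    · rw [barMonomial_of_not_isNonzero hS, map_zero]
  have hnot : ∀ S, e ∉ S → T.IsNonzero R S → barHomotopy k T R e (barMonomial k T R S) =
      koszulSign k S e • barMonomial k T R (insert e S) := by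
    intro S heS hS
    rw [barHomotopy, barLift_barMonomial _ hS, if_neg heS]
  induction x using bar_induction with
  | h0 => simp
  | hadd x y hx hy =>
    convert Submodule.add_mem _ hx hy using 1
    simp only [map_add]
    abel
  | hsmul a x hx =>
    convert Submodule.smul_mem _ a hx using 1
    simp only [map_smul, smul_sub]
  | hmon S hS =>
    rw [barDifferential_barMonomial_sign hS.1, map_sum]
    simp only [map_smul]
    by_cases heS : e ∈ S
    -- Only the term at `e` removes that tensor, and the homotopy puts it back. If `S.erase e`
    -- vanishes, the defect is the whole monomial, which is in the range.
    · rw [hmem S heS, map_zero, sub_zero, sum_eq_single_of_mem e heS]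
      · by_cases hSe : T.IsNonzero R (S.erase e)
        · rw [hnot _ (notMem_erase e S) hSe, insert_erase heS, koszulSign_erase_self, smul_smul,
            koszulSign_mul_self, one_smul, sub_self]
          exact Submodule.zero_mem _
        · rw [barMonomial_of_not_isNonzero hSe, map_zero, smul_zero, sub_zero]
          simpa only [insert_erase heS] using hrange _ (notMem_erase e S) hSe
      · intro f _ hfe
        rw [hmem _ (mem_erase.2 ⟨hfe.symm, heS⟩), smul_zero]
    -- The term at `e` of `D (h x)` gives back `x`. The terms at `f` cancel against those of `h (D
    -- x)`, unless `S.erase f` vanishes; then a multiple of `insert e (S.erase f)` remains, which is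
    -- in the range.
    · rw [hnot S heS hS, map_smul, barDifferential_barMonomial_sign (insert_subset he hS.1),
        sum_insert heS, erase_insert heS, koszulSign_insert_self, smul_add, smul_smul,
        koszulSign_mul_self, one_smul, sub_add_cancel_left, smul_sum, ← neg_add',
        ← sum_add_distrib]
      refine Submodule.neg_mem _ (Submodule.sum_mem _ fun f hf => ?_)
      have hef : e ∉ S.erase f := fun h' => heS (mem_of_mem_erase h')
      rw [erase_insert_of_ne (ne_of_mem_of_not_mem hf heS).symm, smul_smul]
      by_cases hSf : T.IsNonzero R (S.erase f)
      · rw [hnot _ hef hSf, smul_smul, ← add_smul, koszulSign_add_eq_zero heS hf, zero_smul]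
        exact Submodule.zero_mem _
      · rw [barMonomial_of_not_isNonzero hSf, map_zero, smul_zero, add_zero]
        exact Submodule.smul_mem _ _ (hrange _ hef hSf)

theorem HasCyclicHomology.bar_of_link (he : e ∈ T.edges)
    (h : ∀ S, T'.IsNonzero R' S ↔ e ∉ S ∧ ¬ T.IsNonzero R S ∧ T.IsNonzero R (insert e S))
    (h' : HasCyclicHomology (barDifferential k T' R')) :
    HasCyclicHomology (barDifferential k T R) :=
  h'.of_homotopy (barInsert k T' T R' R e) (barHomotopy k T R e)
    (barInsert_injective fun S hS => ⟨((h S).1 hS).1, ((h S).1 hS).2.2⟩)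
    (barDifferential_comp_self k T R) (barInsert_comm h)
    (barHomotopy_defect he fun S h1 h2 h3 => (h S).2 ⟨h1, h2, h3⟩)

/-! ### Induction along the order -/

theorem HasCyclicHomology.bar_of_edges_eq_empty (h : T.edges = ∅) :
    HasCyclicHomology (barDifferential k T R) := by
  refine ⟨barMonomial k T R ∅, ?_, fun x hx => ?_⟩
  · rw [barDifferential_barMonomial_sign (empty_subset _), sum_empty]
  · suffices ∃ a : k, x = a • barMonomial k T R ∅ by
      obtain ⟨a, ha⟩ := this
      exact ⟨a, 0, by rw [map_zero, add_zero, ha]⟩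
    clear hx
    induction x using bar_induction with
    | h0 => exact ⟨0, (zero_smul _ _).symm⟩
    | hadd x y hx hy =>
      obtain ⟨a, rfl⟩ := hx
      obtain ⟨b, rfl⟩ := hy
      exact ⟨a + b, (add_smul _ _ _).symm⟩
    | hsmul a x hx =>
      obtain ⟨b, rfl⟩ := hx
      exact ⟨a * b, smul_smul _ _ _⟩
    | hmon S hS =>
      obtain rfl : S = ∅ := subset_empty.1 (h ▸ hS.1)
      exact ⟨1, (one_smul _ _).symm⟩

/-- This covers a relation consisting of a single corolla, where there is no edge to use. -/
theorem HasCyclicHomology.bar_of_forall_not_isNonzero (h : ∀ S, ¬ T.IsNonzero R S) :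
    HasCyclicHomology (barDifferential k T R) := by
  refine ⟨0, map_zero _, fun x _ => ⟨0, 0, ?_⟩⟩
  have : IsEmpty {S : Finset V // T.IsNonzero R S} := ⟨fun S => h S.1 S.2⟩
  exact Subsingleton.elim _ _

theorem CorollaTree.IsOrder.hasCyclicHomology (hord : T.IsOrder R)
    (hR : ∀ r ∈ R, T.IsSubtree r) : HasCyclicHomology (barDifferential k T R) := by
  induction hord with
  | corolla T R h => exact .bar_of_edges_eq_empty h
  | step T R v s t _ hs hvs huniq ht _ ih =>
    have hmin : ∀ r ∈ minimalRels R, T.IsSubtree r := fun r hr => hR r (minimalRels_subset R hr)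
    have ih := ih fun r' hr' => by
      obtain ⟨r, hr, rfl⟩ := mem_image.1 hr'
      exact (hmin r (mem_of_mem_erase hr)).image_collapse ht (hmin s hs).1
    rcases ht.exists_edge hvs with rfl | ⟨e, hes, hev⟩
    · refine .bar_of_forall_not_isNonzero fun S hS => ?_
      refine ((isNonzero_iff_minimalRels hR S).1 hS).2 _ hs (disjoint_left.2 fun x hx _ => ?_)
      obtain ⟨hx1, hx2⟩ := ht.mem_edgesIn.1 hx
      exact hx2 ((mem_singleton.1 hx1).trans (mem_singleton.1 ht.1).symm)
    -- Both ends of an edge of `r` lie in `r`, so a relation containing `e` contains `v` and equals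
    -- `s`.
    · refine ih.bar_of_link (edgesIn_subset s hes) (isNonzero_contract_iff hR ht hs hes ?_)
      intro r hr her
      refine huniq r hr ?_
      obtain ⟨her1, -, her2⟩ := mem_filter.1 her
      rcases hev with rfl | rfl
      · exact her1
      · exact her2

end BarComplex

theorem mainTheorem6 {k : Type*} [Field k] {V : Type*} [LinearOrder V]
    (w : CorollaTree V) (R : Finset (Finset V))
    (hR : ∀ r ∈ R, w.IsSubtree r)
    (hord : CorollaTree.IsOrder w R) :
    Module.rank k (TotalHomology (barDifferential k w R)) = 0 ∨ Module.rank k (TotalHomology (barDifferential k w R)) = 1 :=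
  (hord.hasCyclicHomology hR).rank_totalHomology
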